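/- Let $p$ be a prime number with $p \equiv 1 \pmod 4$, and let $\mathrm{Paley}(p)$ be the graph with vertex set $X = \mathbb{Z}/p\mathbb{Z}$ in which $x$ and $y$ are adjacent if and only if $x - y$ is a nonzero square. Let $A \in M_X(\mathbb{C})$ be its adjacency matrix; for $Y \subseteq X$ let $E_Y \in M_X(\mathbb{C})$ be the diagonal matrix whose $(x,x)$-entry is $1$ if $x \in Y$ and $0$ otherwise; and let $G_0$ be the stabilizer of the vertex $0$ in the automorphism group of $\mathrm{Paley}(p)$. Define the following unital $\mathbb{C}$-subalgebras of $M_X(\mathbb{C})$: - $\mathcal{T}_1(\mathrm{Paley}(p))$ is generated by $A$ and $E_{\{0\}}$; - $\mathcal{T}_2(\mathrm{Paley}(p))$ is generated by $A$ and all $E_{X_k}$, $k \ge 0$, where $X_k$ is the set of vertices at distance $k$ from $0$; - $\mathcal{T}_3(\mathrm{Paley}(p))$ is generated by $A$ and all $E_Y$, where $Y$ runs over the $G_0$-orbits on $X$; - $\mathcal{T}_4(\mathrm{Paley}(p))$ consists of all $M \in M_X(\mathbb{C})$ with $M_{\sigma(x),\sigma(y)} = M_{x,y}$ for all $\sigma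 \in G_0$ and all $x, y \in X$. Then, for every prime $p \ge 7$ with $p \equiv 1 \pmod 4$, $$\mathcal{T}_1(\mathrm{Paley}(p)) \subsetneq \mathcal{T}_2(\mathrm{Paley}(p)) = \mathcal{T}_3(\mathrm{Paley}(p)) \subsetneq \mathcal{T}_4(\mathrm{Paley}(p)).$$ Moreover, there are infinitely many primes $p \equiv 1 \pmod 4$ with $\mathcal{T}_3(\mathrm{Paley}(p)) \ne \mathcal{T}_4(\mathrm{Paley}(p))$. -/

import Mathlib

noncomputable section

namespace TerwilligerPaley

section Algebras

variable {V : Type*} [Fintype V] [DecidableEq V]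

/-- The adjacency matrix `A` of `Γ`, with complex entries. -/
def adjMat (Γ : SimpleGraph V) : Matrix V V ℂ :=
  open Classical in Γ.adjMatrix ℂ

/-- The diagonal `0`-`1` matrix `E_Y` of a set `Y` of vertices. -/
def diagIdem (Y : Set V) : Matrix V V ℂ :=
  Matrix.diagonal (Y.indicator 1)

/-- The set of vertices at distance `k` from `x₀` (`edist` is `∞` if there is no walk). -/
def sphere (Γ : SimpleGraph V) (x₀ : V) (k : ℕ) : Set V :=
  {x | Γ.edist x₀ x = k}

/-- The stabilizer of `x₀` in the automorphism group of `Γ`. -/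
abbrev autStab (Γ : SimpleGraph V) (x₀ : V) : Subgroup (Γ ≃g Γ) :=
  MulAction.stabilizer (Γ ≃g Γ) x₀

/-- The algebra generated by `A` and `E_{x₀}`. -/
def T₁ (Γ : SimpleGraph V) (x₀ : V) : Subalgebra ℂ (Matrix V V ℂ) :=
  Algebra.adjoin ℂ {adjMat Γ, diagIdem {x₀}}

/-- The Terwilliger algebra, generated by `A` and the `E_Y` for the classes `Y` of the distance
partition with respect to `x₀`. For `k` larger than the maximal distance from `x₀` the sphere is
empty and contributes the zero matrix. -/
def T₂ (Γ : SimpleGraph V) (x₀ : V) : Subalgebra ℂ (Matrix V V ℂ) :=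
  Algebra.adjoin ℂ ({adjMat Γ} ∪ Set.range fun k : ℕ => diagIdem (sphere Γ x₀ k))

/-- The algebra generated by `A` and the `E_Y` for the orbits `Y` of the stabilizer of `x₀` in the
automorphism group. -/
def T₃ (Γ : SimpleGraph V) (x₀ : V) : Subalgebra ℂ (Matrix V V ℂ) :=
  Algebra.adjoin ℂ
    ({adjMat Γ} ∪ Set.range fun y : V => diagIdem (MulAction.orbit (autStab Γ x₀) y))

/-- The centralizer algebra: the matrices that are invariant under the simultaneous permutation of
rows and columns by every automorphism fixing `x₀`. -/
def T₄ (Γ : SimpleGraph V) (x₀ : V) : Subalgebra ℂ (Matrix V V ℂ) where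
  carrier := {M | ∀ σ ∈ autStab Γ x₀, ∀ x y : V, M (σ x) (σ y) = M x y}
  mul_mem' := by
    intro M N hM hN σ hσ x y
    rw [Matrix.mul_apply, Matrix.mul_apply,
      ← Equiv.sum_comp σ.toEquiv fun z => M (σ x) z * N z (σ y)]
    refine Finset.sum_congr rfl fun z _ => ?_
    exact congrArg₂ (· * ·) (hM σ hσ x z) (hN σ hσ z y)
  add_mem' := by
    intro M N hM hN σ hσ x y
    rw [Matrix.add_apply, Matrix.add_apply, hM σ hσ, hN σ hσ]
  algebraMap_mem' := by
    intro c σ hσ x y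
    simp [Matrix.algebraMap_matrix_apply]

end Algebras

section Paley

/-- The Paley graph on a finite field `F` with `|F| ≡ 1 (mod 4)`: two vertices are adjacent if and
only if their difference is a nonzero square. -/
def paleyGraph (F : Type*) [Field F] [Fintype F] (hF : Fintype.card F % 4 = 1) :
    SimpleGraph F where
  Adj x y := x ≠ y ∧ IsSquare (x - y)
  symm := ⟨by
    rintro x y ⟨hne, hsq⟩
    refine ⟨hne.symm, ?_⟩
    have h : IsSquare (-1 : F) := FiniteField.isSquare_neg_one_iff.2 (by omega)
    have h' := h.mul hsq
    rwa [neg_one_mul, neg_sub] at h'⟩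
  loopless := ⟨fun x h => h.1 rfl⟩

/-- The Paley graph on `p` vertices, for a prime number `p ≡ 1 (mod 4)`. -/
def paley (p : ℕ) [Fact p.Prime] (hp : p % 4 = 1) : SimpleGraph (ZMod p) :=
  paleyGraph (ZMod p) (by rw [ZMod.card]; exact hp)

end Paley

end TerwilligerPaley

end

/-! Write χ for the quadratic character and call a matrix biinvariant if its rows and columns can be
scaled independently by nonzero squares. The biinvariant matrices absorb multiplication, on either
side, by matrices invariant under simultaneous scaling; each strict inclusion is detected modulo
them.

T₁ ≠ T₂: A² is a combination of 1, A and a constant matrix, and E_{0} is biinvariant, so T₁ lies in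
span(1, A) + biinvariant (`adjacencyAddBiinvariant`). Comparing entries shows that E_{X₁} does not.

T₂ = T₃: the spheres and the orbits are both {0}, the nonzero squares and the nonsquares.

T₃ ≠ T₄: let W be the twisted inversion. Since χ(x⁻¹ - y) = χ(x) χ(1 - xy) for x ≠ 0, A commutes
with W modulo biinvariant matrices; so do the orbit idempotents, hence all of T₃. The permutation
matrix of x ↦ 4x does not. It lies in T₄ because automorphisms fixing 0 are scalings (Carlitz): such
a σ has only squares as difference quotients, so it misses more than half of the directions, and a
power-sum argument makes it affine. -/

/-! ### Power sums and functions missing many directions. -/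

open Polynomial in
theorem ZMod.sum_eval_eq_neg_coeff (p : ℕ) [Fact p.Prime] (q : (ZMod p)[X])
    (hq : q.natDegree ≤ p - 1) : ∑ x : ZMod p, q.eval x = -q.coeff (p - 1) := by
  have hp : 2 ≤ p := (Fact.out : p.Prime).two_le
  have h (x : ZMod p) : q.eval x = ∑ i ∈ Finset.range (p - 1 + 1), q.coeff i * x ^ i :=
    eval_eq_sum_range' (by omega) x
  simp_rw [h]
  rw [Finset.sum_comm, Finset.sum_range_succ, Finset.sum_eq_zero, zero_add]
  · rw [← Finset.mul_sum]
    have h1 : ∑ x : ZMod p, x ^ (p - 1) = -1 := by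
      have h2 (x : ZMod p) : x ^ (p - 1) = 1 - if x = 0 then 1 else 0 := by
        split_ifs with hx
        · rw [hx, zero_pow (by omega), sub_self]
        · rw [ZMod.pow_card_sub_one_eq_one hx, sub_zero]
      simp_rw [h2]
      simp
    rw [h1, mul_neg_one]
  · intro i hi
    rw [← Finset.mul_sum, FiniteField.sum_pow_lt_card_sub_one, mul_zero]
    rw [ZMod.card]
    exact Finset.mem_range.1 hi

open Polynomial in
/-- If `x ↦ f x - c x` is injective for more than `k` values of `c`, then the mixed power sums of
`f` of degree `k` vanish. -/
theorem ZMod.sum_pow_mul_pow_eq_zero (p : ℕ) [Fact p.Prime] (f : ZMod p → ZMod p)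
    (S : Finset (ZMod p)) (hS : ∀ c ∈ S, Function.Injective fun x => f x - c * x) (i j : ℕ)
    (hk : i + j < S.card) (hkp : i + j < p - 1) : ∑ x : ZMod p, f x ^ i * x ^ j = 0 := by
  set k := i + j with hkdef
  -- The value of P at c is the expansion of ∑ (f x - c x)^k. For c in S it equals ∑ y^k = 0, so P
  -- has more roots than its degree allows.
  let P : (ZMod p)[X] := ∑ m ∈ Finset.range (k + 1),
    C ((∑ x : ZMod p, f x ^ m * x ^ (k - m)) * (-1) ^ (k - m) * (k.choose m : ZMod p)) *
      X ^ (k - m)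
  have hP : P = 0 := by
    refine eq_zero_of_natDegree_lt_card_of_eval_eq_zero' P S (fun c hc => ?_)
      (lt_of_le_of_lt (natDegree_sum_le_of_forall_le _ _ fun m _ =>
        (natDegree_C_mul_X_pow_le _ _).trans (Nat.sub_le k m)) hk)
    have hb : Function.Bijective fun x => f x - c * x := (hS c hc).bijective_of_finite
    have h0 : ∑ x : ZMod p, (f x - c * x) ^ k = 0 := by
      rw [hb.sum_comp fun y => y ^ k]
      exact FiniteField.sum_pow_lt_card_sub_one _ _ (by rwa [ZMod.card])
    rw [← h0]
    simp_rw [sub_eq_add_neg, add_pow]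
    rw [Finset.sum_comm, eval_finsetSum]
    refine Finset.sum_congr rfl fun m _ => ?_
    rw [eval_mul, eval_C, eval_pow, eval_X, Finset.sum_mul, Finset.sum_mul, Finset.sum_mul]
    refine Finset.sum_congr rfl fun x _ => ?_
    rw [neg_pow (c * x), mul_pow]
    ring
  have hc : P.coeff j =
      (∑ x : ZMod p, f x ^ i * x ^ j) * (-1) ^ j * (k.choose i : ZMod p) := by
    have hj : k - i = j := by omega
    rw [finsetSum_coeff, Finset.sum_eq_single i]
    · rw [hj, coeff_C_mul_X_pow, if_pos rfl]
    · intro m hm hmi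
      rw [coeff_C_mul_X_pow, if_neg]
      have := Finset.mem_range.1 hm
      omega
    · intro h
      exact absurd (Finset.mem_range.2 (by omega)) h
  rw [hP, coeff_zero] at hc
  have hch : (k.choose i : ZMod p) ≠ 0 := by
    rw [Ne, ZMod.natCast_eq_zero_iff]
    intro hd
    have h3 : p ∣ k.factorial := by
      rw [← Nat.choose_mul_factorial_mul_factorial (show i ≤ k by omega)]
      exact (hd.mul_right _).mul_right _
    have := ((Fact.out : p.Prime).dvd_factorial).1 h3
    omega
  simpa [hch] using hc.symm

/-- Let a be the quotient and b the remainder. The claim amounts to b ≤ a(d - 2), which follows from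
b ≤ d - 1 ≤ 2(d - 2) when a ≥ 2 and d ≥ 3; the cases d = 2 and a = 1 are direct. -/
theorem Nat.div_add_mod_le_half (d m : ℕ) (hd : 2 ≤ d) (hm : d ≤ 2 * m) :
    2 * m / d + 2 * m % d ≤ m := by
  have h1 := Nat.div_add_mod (2 * m) d
  have h2 := Nat.mod_lt (2 * m) (show 0 < d by omega)
  have h3 : 1 ≤ 2 * m / d := (Nat.one_le_div_iff (by omega)).2 hm
  rcases hd.eq_or_lt with rfl | hd
  · omega
  generalize 2 * m / d = a at *
  generalize 2 * m % d = b at *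
  rcases h3.eq_or_lt with rfl | h3
  · omega
  obtain ⟨e, rfl⟩ : ∃ e, d = e + 3 := ⟨d - 3, by omega⟩
  nlinarith [Nat.zero_le e, Nat.mul_le_mul_right e h3]

open Polynomial in
/-- A function on `ZMod p` that misses at least half of the directions is affine. -/
theorem ZMod.affine_of_injective_sub_mul (p : ℕ) [Fact p.Prime] (hodd : p % 2 = 1)
    (f : ZMod p → ZMod p) (S : Finset (ZMod p)) (hcard : p < 2 * S.card)
    (hS : ∀ c ∈ S, Function.Injective fun x => f x - c * x) :
    ∃ a b : ZMod p, ∀ x, f x = a * x + b := by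
  let g : (ZMod p)[X] := Lagrange.interpolate Finset.univ id f
  have hg (x : ZMod p) : g.eval x = f x :=
    Lagrange.eval_interpolate_at_node f (Set.injOn_id _) (Finset.mem_univ x)
  have hdeg : g.natDegree ≤ p - 1 := by
    have h := Lagrange.degree_interpolate_le (s := Finset.univ) (v := id) f (Set.injOn_id _)
    rw [Finset.card_univ, ZMod.card] at h
    exact natDegree_le_of_degree_le h
  suffices h1 : g.natDegree ≤ 1 by
    obtain ⟨a, b, h⟩ := exists_eq_X_add_C_of_natDegree_le_one h1
    refine ⟨a, b, fun x => ?_⟩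
    rw [← hg, h]
    simp
  by_contra! hd
  obtain ⟨m, hm⟩ : ∃ m, p = 2 * m + 1 := ⟨p / 2, by omega⟩
  have hab := Nat.div_add_mod_le_half g.natDegree m (by omega) (by omega)
  have hdm := Nat.div_add_mod (2 * m) g.natDegree
  -- The polynomial g^a X^b has degree exactly p - 1, so its sum over the field is minus its nonzero
  -- leading coefficient; yet a + b ≤ (p - 1)/2 < |S| forces that sum to vanish.
  set a := 2 * m / g.natDegree
  set b := 2 * m % g.natDegree
  have hg0 : g ≠ 0 := by
    rintro h
    rw [h] at hd
    simp at hd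
  have hq : (g ^ a * X ^ b).natDegree = p - 1 := by
    rw [natDegree_mul (pow_ne_zero _ hg0) (pow_ne_zero _ X_ne_zero), natDegree_pow,
      natDegree_X_pow, mul_comm a, hdm]
    omega
  have hs := ZMod.sum_eval_eq_neg_coeff p (g ^ a * X ^ b) hq.le
  rw [← hq, coeff_natDegree] at hs
  have hz : ∑ x : ZMod p, (g ^ a * X ^ b).eval x = 0 := by
    simp_rw [eval_mul, eval_pow, eval_X, hg]
    exact ZMod.sum_pow_mul_pow_eq_zero p f S hS a b (by omega) (by omega)
  rw [hz, eq_comm, neg_eq_zero, leadingCoeff_eq_zero] at hs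
  exact mul_ne_zero (pow_ne_zero _ hg0) (pow_ne_zero _ X_ne_zero) hs

namespace TerwilligerPaley

open Classical in
theorem diagIdem_apply {V : Type*} [DecidableEq V] (Y : Set V) (x y : V) :
    diagIdem Y x y = if x = y ∧ x ∈ Y then 1 else 0 := by
  by_cases h : x = y <;> simp [diagIdem, Set.indicator_apply, h]

theorem smul_mem_orbit_iff {G X : Type*} [Group G] [MulAction G X] (g : G) (x y : X) :
    g • x ∈ MulAction.orbit G y ↔ x ∈ MulAction.orbit G y := by
  rw [← MulAction.orbit_eq_iff, MulAction.orbit_smul, MulAction.orbit_eq_iff]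

/-! ### Square-invariant matrices and the twisted inversion. -/

section Invariance

variable {F : Type*} [Field F] [Fintype F] [DecidableEq F]

/-- Invariance of a matrix under simultaneous scaling of rows and columns by nonzero squares. -/
def SqInvariant (M : Matrix F F ℂ) : Prop :=
  ∀ s : F, s ≠ 0 → ∀ x y, M (s ^ 2 * x) (s ^ 2 * y) = M x y

/-- Invariance of a matrix under independent scalings of rows and columns by nonzero squares. -/
def SqBiinvariant (M : Matrix F F ℂ) : Prop :=
  ∀ s t : F, s ≠ 0 → t ≠ 0 → ∀ x y, M (s ^ 2 * x) (t ^ 2 * y) = M x y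

omit [Fintype F] [DecidableEq F] in
theorem SqBiinvariant.sqInvariant {M : Matrix F F ℂ} (hM : SqBiinvariant M) : SqInvariant M :=
  fun s hs x y => hM s s hs hs x y

omit [Fintype F] [DecidableEq F] in
theorem SqBiinvariant.add {M N : Matrix F F ℂ} (hM : SqBiinvariant M) (hN : SqBiinvariant N) :
    SqBiinvariant (M + N) := fun s t hs ht x y => by
  rw [Matrix.add_apply, Matrix.add_apply, hM s t hs ht, hN s t hs ht]

omit [Fintype F] [DecidableEq F] in
theorem SqBiinvariant.smul {M : Matrix F F ℂ} (hM : SqBiinvariant M) (c : ℂ) :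
    SqBiinvariant (c • M) := fun s t hs ht x y => by
  rw [Matrix.smul_apply, Matrix.smul_apply, hM s t hs ht]

omit [Fintype F] [DecidableEq F] in
theorem sqBiinvariant_zero : SqBiinvariant (0 : Matrix F F ℂ) := fun _ _ _ _ _ _ => rfl

omit [Fintype F] [DecidableEq F] in
theorem SqInvariant.add {M N : Matrix F F ℂ} (hM : SqInvariant M) (hN : SqInvariant N) :
    SqInvariant (M + N) := fun s hs x y => by
  rw [Matrix.add_apply, Matrix.add_apply, hM s hs, hN s hs]

omit [Fintype F] in
theorem sqInvariant_one : SqInvariant (1 : Matrix F F ℂ) := fun s hs x y => by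
  simp [Matrix.one_apply, hs]

omit [Fintype F] [DecidableEq F] in
theorem SqInvariant.smul {M : Matrix F F ℂ} (hM : SqInvariant M) (c : ℂ) :
    SqInvariant (c • M) := fun s hs x y => by
  rw [Matrix.smul_apply, Matrix.smul_apply, hM s hs]

omit [DecidableEq F] in
theorem sum_sq_mul (s : F) (hs : s ≠ 0) (f : F → ℂ) : ∑ z, f (s ^ 2 * z) = ∑ z, f z :=
  (mulLeft_bijective₀ (s ^ 2) (pow_ne_zero 2 hs)).sum_comp f

omit [DecidableEq F] in
theorem SqInvariant.mul {M N : Matrix F F ℂ} (hM : SqInvariant M) (hN : SqInvariant N) :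
    SqInvariant (M * N) := fun s hs x y => by
  rw [Matrix.mul_apply, Matrix.mul_apply, ← sum_sq_mul s hs]
  exact Finset.sum_congr rfl fun z _ => by rw [hM s hs, hN s hs]

omit [DecidableEq F] in
theorem SqInvariant.mul_sqBiinvariant {M N : Matrix F F ℂ} (hM : SqInvariant M)
    (hN : SqBiinvariant N) : SqBiinvariant (M * N) := fun s t hs ht x y => by
  rw [Matrix.mul_apply, Matrix.mul_apply, ← sum_sq_mul s hs]
  exact Finset.sum_congr rfl fun z _ => by rw [hM s hs, hN s t hs ht]

omit [DecidableEq F] in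
theorem SqBiinvariant.mul_sqInvariant {M N : Matrix F F ℂ} (hM : SqBiinvariant M)
    (hN : SqInvariant N) : SqBiinvariant (M * N) := fun s t hs ht x y => by
  rw [Matrix.mul_apply, Matrix.mul_apply, ← sum_sq_mul t ht]
  exact Finset.sum_congr rfl fun z _ => by rw [hN t ht, hM s t hs ht]

/-- The matrix of `g ↦ (x ↦ χ x * g x⁻¹)`, where `χ` is the quadratic character. -/
def twistedInversion (F : Type*) [Field F] [Fintype F] [DecidableEq F] : Matrix F F ℂ :=
  fun x y => if y = x⁻¹ then (quadraticChar F x : ℂ) else 0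

theorem twistedInversion_mul_apply (M : Matrix F F ℂ) (x y : F) :
    (twistedInversion F * M) x y = quadraticChar F x * M x⁻¹ y := by
  simp [Matrix.mul_apply, twistedInversion]

theorem mul_twistedInversion_apply (M : Matrix F F ℂ) (x y : F) :
    (M * twistedInversion F) x y = M x y⁻¹ * quadraticChar F y := by
  have h (z : F) : y = z⁻¹ ↔ z = y⁻¹ := by rw [eq_comm, inv_eq_iff_eq_inv]
  have h2 : quadraticChar F y⁻¹ = quadraticChar F y := by
    by_cases hy : y = 0
    · simp [hy]
    · have : quadraticChar F (y⁻¹) * quadraticChar F (y ^ 2) = quadraticChar F y := by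
        rw [← map_mul]; congr 1; field_simp
      rwa [quadraticChar_sq_one' hy, mul_one] at this
  simp [Matrix.mul_apply, twistedInversion, h, ← h2, -quadraticChar_apply]

/-- The matrices that are invariant under scaling by squares and commute with the twisted inversion
up to a biinvariant matrix. -/
def almostCentralizer (F : Type*) [Field F] [Fintype F] [DecidableEq F] :
    Subalgebra ℂ (Matrix F F ℂ) where
  carrier := {M | SqInvariant M ∧
    SqBiinvariant (twistedInversion F * M - M * twistedInversion F)}
  mul_mem' := by
    rintro M N ⟨hM, hM'⟩ ⟨hN, hN'⟩
    refine ⟨hM.mul hN, ?_⟩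
    -- Leibniz rule: [W, MN] = [W, M] N + M [W, N].
    have h := (hM'.mul_sqInvariant hN).add (hM.mul_sqBiinvariant hN')
    convert h using 1
    noncomm_ring
  add_mem' := by
    rintro M N ⟨hM, hM'⟩ ⟨hN, hN'⟩
    refine ⟨hM.add hN, ?_⟩
    convert hM'.add hN' using 1
    noncomm_ring
  algebraMap_mem' := by
    intro c
    rw [Algebra.algebraMap_eq_smul_one]
    refine ⟨sqInvariant_one.smul c, ?_⟩
    rw [mul_smul_comm, smul_mul_assoc, mul_one, one_mul, sub_self]
    exact sqBiinvariant_zero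

/-- Here the commutator is zero: x⁻¹ = (x⁻¹)² x, so Y is stable under inversion. -/
theorem diagIdem_mem_almostCentralizer (Y : Set F)
    (hY : ∀ s : F, s ≠ 0 → ∀ x, s ^ 2 * x ∈ Y ↔ x ∈ Y) : diagIdem Y ∈ almostCentralizer F := by
  constructor
  · intro s hs x y
    classical
    rw [diagIdem_apply, diagIdem_apply]
    exact if_congr (and_congr (mul_right_inj' (pow_ne_zero 2 hs)) (hY s hs x)) rfl rfl
  · convert sqBiinvariant_zero (F := F)
    ext x y
    have hinv (z : F) : z⁻¹ ∈ Y ↔ z ∈ Y := by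
      by_cases hz : z = 0
      · simp [hz]
      · rw [← hY z⁻¹ (inv_ne_zero hz) z]
        congr! 1
        field_simp
    rw [Matrix.sub_apply, diagIdem, Matrix.mul_diagonal, Matrix.diagonal_mul, Matrix.zero_apply]
    by_cases h : y = x⁻¹
    · have hi : Y.indicator (1 : F → ℂ) x⁻¹ = Y.indicator 1 x := by
        classical
        rw [Set.indicator_apply, Set.indicator_apply]
        simp [hinv]
      rw [h, hi, mul_comm, sub_self]
    · simp [h, twistedInversion]

end Invariance

/-! ### The adjacency matrix in terms of the quadratic character. -/

section PaleyGraph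

variable {F : Type*} [Field F] [Fintype F] [DecidableEq F] (hF : Fintype.card F % 4 = 1)

theorem two_mul_adjMat_apply (x y : F) : 2 * adjMat (paleyGraph F hF) x y =
    quadraticChar F (x - y) + 1 - if x = y then 1 else 0 := by
  classical
  have h0 : adjMat (paleyGraph F hF) x y = if x ≠ y ∧ IsSquare (x - y) then 1 else 0 := by
    rw [adjMat, SimpleGraph.adjMatrix_apply]
    congr
  rw [h0]
  by_cases h : x = y
  · simp [h]
  · have h' := sub_ne_zero.2 h
    rw [if_neg h]
    by_cases hs : IsSquare (x - y)
    · rw [(quadraticChar_one_iff_isSquare h').2 hs, if_pos ⟨h, hs⟩]; norm_num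
    · rw [quadraticChar_neg_one_iff_not_isSquare.2 hs, if_neg fun h => hs h.2]; norm_num

theorem sqInvariant_adjMat : SqInvariant (adjMat (paleyGraph F hF)) := fun s hs x y => by
  have h2 : (2 : ℂ) ≠ 0 := two_ne_zero
  refine mul_left_cancel₀ h2 ?_
  rw [two_mul_adjMat_apply, two_mul_adjMat_apply, ← mul_sub, map_mul, quadraticChar_sq_one' hs]
  simp [hs]

theorem adjMat_mem_almostCentralizer : adjMat (paleyGraph F hF) ∈ almostCentralizer F := by
  refine ⟨sqInvariant_adjMat hF, fun s t hs ht x y => ?_⟩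
  -- Keeping x x⁻¹ unsimplified makes one formula cover zero arguments, where 0⁻¹ = 0. For nonzero x
  -- and y the first two terms cancel, leaving χ(x) - χ(y).
  have key (x y : F) : 2 * (twistedInversion F * adjMat (paleyGraph F hF) -
      adjMat (paleyGraph F hF) * twistedInversion F) x y =
      ((quadraticChar F (x * x⁻¹ - x * y) - quadraticChar F (y * y⁻¹ - x * y) +
        quadraticChar F x - quadraticChar F y : ℤ) : ℂ) := by
    rw [Matrix.sub_apply, twistedInversion_mul_apply, mul_twistedInversion_apply, mul_sub,
      mul_left_comm, ← mul_assoc 2 (adjMat _ _ _), two_mul_adjMat_apply, two_mul_adjMat_apply]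
    have h1 : quadraticChar F (x * x⁻¹ - x * y) = quadraticChar F x * quadraticChar F (x⁻¹ - y) := by
      rw [← map_mul, mul_sub]
    have h2 : quadraticChar F (y * y⁻¹ - x * y) = quadraticChar F (x - y⁻¹) * quadraticChar F y := by
      have hm : quadraticChar F (-1) = 1 :=
        (quadraticChar_one_iff_isSquare (by simp)).2
          (FiniteField.isSquare_neg_one_iff.2 (by omega))
      rw [← map_mul, ← one_mul (quadraticChar F ((x - y⁻¹) * y)), ← hm, ← map_mul]
      congr 1; ring
    rw [h1, h2]
    push_cast
    have h3 : (x⁻¹ = y) ↔ x = y⁻¹ := inv_eq_iff_eq_inv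
    by_cases h : x = y⁻¹
    · have h4 : quadraticChar F x = quadraticChar F y := by
        by_cases hy : y = 0
        · simp [h, hy]
        · rw [h, ← one_mul (quadraticChar F y⁻¹), ← quadraticChar_sq_one' hy, ← map_mul]
          congr 1; field_simp
      rw [if_pos (h3.2 h), if_pos h, h4]; ring
    · rw [if_neg (mt h3.1 h), if_neg h]; ring
  refine mul_left_cancel₀ (two_ne_zero (α := ℂ)) ?_
  rw [key, key, map_mul, map_mul _ (t ^ 2), quadraticChar_sq_one' hs, quadraticChar_sq_one' ht]
  have h1 (z : F) (hz : z ≠ 0) : z * z⁻¹ = 1 := mul_inv_cancel₀ hz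
  have hs2 := pow_ne_zero 2 hs
  have ht2 := pow_ne_zero 2 ht
  by_cases hx : x = 0 <;> by_cases hy : y = 0
  · simp [hx, hy]
  · rw [h1 y hy, h1 _ (mul_ne_zero ht2 hy)]
    simp [hx]
  · rw [h1 x hx, h1 _ (mul_ne_zero hs2 hx)]
    simp [hy]
  · rw [h1 x hx, h1 _ (mul_ne_zero hs2 hx), h1 y hy, h1 _ (mul_ne_zero ht2 hy)]
    simp

/-- Multiplication by a nonsquare injects the nonzero squares into the nonsquares; the element 0
makes the inequality strict. -/
theorem card_lt_two_mul_card_quadraticChar_ne_one (hF2 : ringChar F ≠ 2) :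
    Fintype.card F < 2 * (Finset.univ.filter fun c : F => quadraticChar F c ≠ 1).card := by
  obtain ⟨n, hn⟩ := quadraticChar_exists_neg_one hF2
  have h1 := Finset.card_filter_add_card_filter_not (s := (Finset.univ : Finset F))
    (fun c => quadraticChar F c = 1)
  rw [Finset.card_univ] at h1
  have hn0 : n ≠ 0 := by rintro rfl; simp at hn
  have h2 : (Finset.univ.filter fun c : F => quadraticChar F c = 1).card ≤
      ((Finset.univ.filter fun c : F => quadraticChar F c ≠ 1).erase 0).card := by
    refine Finset.card_le_card_of_injOn (fun x => n * x) ?_ (mul_right_injective₀ hn0).injOn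
    intro x hx
    have hx1 : quadraticChar F x = 1 := (Finset.mem_filter.1 hx).2
    have hx0 : x ≠ 0 := by rintro rfl; simp at hx1
    simp [hn0, hx0, hn, hx1, -quadraticChar_apply]
  have h3 : (0 : F) ∈ Finset.univ.filter fun c : F => quadraticChar F c ≠ 1 := by simp
  have h4 := Finset.card_erase_add_one h3
  simp only [ne_eq] at *
  omega

end PaleyGraph

/-! ### Automorphisms fixing 0, and the strictness of T₃ ⊂ T₄. -/

section Prime

variable (p : ℕ) [Fact p.Prime] (hp : p % 4 = 1)

theorem paley_adj (x y : ZMod p) : (paley p hp).Adj x y ↔ x ≠ y ∧ IsSquare (x - y) := Iff.rfl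

theorem quadraticChar_sub_eq_one_iff (x y : ZMod p) :
    quadraticChar (ZMod p) (x - y) = 1 ↔ (paley p hp).Adj x y := by
  rw [paley_adj]
  constructor
  · intro h
    have h0 : x - y ≠ 0 := by intro h0; simp [h0] at h
    exact ⟨sub_ne_zero.1 h0, (quadraticChar_one_iff_isSquare h0).1 h⟩
  · rintro ⟨h, hs⟩
    exact (quadraticChar_one_iff_isSquare (sub_ne_zero.2 h)).2 hs

theorem quadraticChar_iso_sub (σ : paley p hp ≃g paley p hp) (x y : ZMod p) :
    quadraticChar (ZMod p) (σ x - σ y) = quadraticChar (ZMod p) (x - y) := by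
  by_cases h : x = y
  · simp [h]
  have h1 := quadraticChar_sub_eq_one_iff p hp x y
  have h2 := quadraticChar_sub_eq_one_iff p hp (σ x) (σ y)
  rw [σ.map_adj_iff, ← h1] at h2
  rcases quadraticChar_dichotomy (sub_ne_zero.2 h) with h3 | h3 <;>
  rcases quadraticChar_dichotomy (sub_ne_zero.2 (σ.injective.ne h)) with h4 | h4 <;>
  simp_all

/-- Carlitz's theorem for prime fields: the automorphisms of a Paley graph that fix `0` are
scalings. -/
theorem exists_eq_mul_of_mem_autStab (σ : paley p hp ≃g paley p hp)
    (hσ : σ ∈ autStab (paley p hp) 0) : ∃ a : ZMod p, a ≠ 0 ∧ ∀ x, σ x = a * x := by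
  have h0 : σ 0 = 0 := hσ
  have hc : ringChar (ZMod p) ≠ 2 := by
    rw [ZMod.ringChar_zmod_n]; omega
  have hcard := card_lt_two_mul_card_quadraticChar_ne_one hc
  rw [ZMod.card] at hcard
  -- A collision of σ x - c x at two points makes c a difference quotient of σ, and then χ(c) = 1.
  obtain ⟨a, b, h⟩ := ZMod.affine_of_injective_sub_mul p (by omega) σ _ hcard fun c hc x y hxy => by
    by_contra hne
    refine (Finset.mem_filter.1 hc).2 ?_
    have h1 : σ x - σ y = c * (x - y) := by linear_combination hxy
    have h2 := quadraticChar_iso_sub p hp σ x y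
    rw [h1, map_mul] at h2
    have h3 : quadraticChar (ZMod p) (x - y) ≠ 0 := by
      rw [Ne, quadraticChar_eq_zero_iff]; exact sub_ne_zero.2 hne
    exact mul_right_cancel₀ h3 (h2.trans (one_mul _).symm)
  have hb : b = 0 := by simpa [h0] using (h 0).symm
  refine ⟨a, ?_, fun x => by rw [h, hb, add_zero]⟩
  rintro rfl
  exact zero_ne_one (σ.injective ((h 0).trans (by rw [h 1]; ring)))

/-- Scaling by a nonzero square as an automorphism of the Paley graph. -/
def scaling (s : ZMod p) (hs : s ≠ 0) : paley p hp ≃g paley p hp where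
  toEquiv := Equiv.mulLeft₀ (s ^ 2) (pow_ne_zero 2 hs)
  map_rel_iff' := by
    intro x y
    rw [← quadraticChar_sub_eq_one_iff, ← quadraticChar_sub_eq_one_iff]
    simp only [Equiv.mulLeft₀_apply]
    rw [← mul_sub, map_mul, quadraticChar_sq_one' hs, one_mul]

theorem scaling_mem_autStab (s : ZMod p) (hs : s ≠ 0) :
    scaling p hp s hs ∈ autStab (paley p hp) 0 := mul_zero (s ^ 2)

theorem sq_mul_mem_orbit_iff (s : ZMod p) (hs : s ≠ 0) (x y : ZMod p) :
    s ^ 2 * x ∈ MulAction.orbit (autStab (paley p hp) 0) y ↔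
      x ∈ MulAction.orbit (autStab (paley p hp) 0) y := by
  have h : s ^ 2 * x = (⟨scaling p hp s hs, scaling_mem_autStab p hp s hs⟩ :
    autStab (paley p hp) 0) • x := rfl
  rw [h, smul_mem_orbit_iff]

theorem mem_orbit_iff (x y : ZMod p) : x ∈ MulAction.orbit (autStab (paley p hp) 0) y ↔
    quadraticChar (ZMod p) x = quadraticChar (ZMod p) y := by
  constructor
  · rintro ⟨⟨σ, hσ⟩, rfl⟩
    have h0 : σ 0 = 0 := hσ
    have h := quadraticChar_iso_sub p hp σ y 0
    rw [h0, sub_zero, sub_zero] at h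
    exact h
  · intro h
    by_cases hx : x = 0
    · rw [hx, MulChar.map_zero, eq_comm, quadraticChar_eq_zero_iff] at h
      rw [hx, h]
      exact MulAction.mem_orbit_self _
    have hy : y ≠ 0 := by
      rintro rfl
      rw [MulChar.map_zero, quadraticChar_eq_zero_iff] at h
      exact hx h
    have hs : quadraticChar (ZMod p) (x / y) = 1 := by
      have h1 : quadraticChar (ZMod p) (x / y) * quadraticChar (ZMod p) y =
          quadraticChar (ZMod p) x := by rw [← map_mul, div_mul_cancel₀ _ hy]
      rw [h] at h1
      exact mul_right_cancel₀ (by rwa [Ne, quadraticChar_eq_zero_iff])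
        (h1.trans (one_mul _).symm)
    obtain ⟨s, hs⟩ := (quadraticChar_one_iff_isSquare (div_ne_zero hx hy)).1 hs
    have hs0 : s ≠ 0 := by
      rintro rfl
      rw [zero_mul] at hs
      exact div_ne_zero hx hy hs
    have hxs : x = s ^ 2 * y := by rw [pow_two, ← hs, div_mul_cancel₀ _ hy]
    rw [hxs, sq_mul_mem_orbit_iff p hp s hs0]
    exact MulAction.mem_orbit_self _

theorem T₃_le_almostCentralizer : T₃ (paley p hp) 0 ≤ almostCentralizer (ZMod p) := by
  refine Algebra.adjoin_le ?_
  rintro M (rfl | ⟨y, rfl⟩)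
  · exact adjMat_mem_almostCentralizer _
  · exact diagIdem_mem_almostCentralizer _ fun s hs x => sq_mul_mem_orbit_iff p hp s hs x y

theorem T₃_le_T₄ : T₃ (paley p hp) 0 ≤ T₄ (paley p hp) 0 := by
  refine Algebra.adjoin_le ?_
  rintro M (rfl | ⟨y, rfl⟩) σ hσ x z
  · have h : (paley p hp).Adj (σ x) (σ z) ↔ (paley p hp).Adj x z := σ.map_adj_iff
    classical
    exact if_congr h rfl rfl
  · have h : σ x ∈ MulAction.orbit (autStab (paley p hp) 0) y ↔
        x ∈ MulAction.orbit (autStab (paley p hp) 0) y :=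
      smul_mem_orbit_iff (⟨σ, hσ⟩ : autStab (paley p hp) 0) x y
    classical
    dsimp only
    rw [diagIdem_apply, diagIdem_apply]
    exact if_congr (and_congr σ.injective.eq_iff h) rfl rfl

theorem natCast_ne_zero_of_lt (n : ℕ) (h0 : 0 < n) (h : n < p) : (n : ZMod p) ≠ 0 := by
  rw [Ne, ZMod.natCast_eq_zero_iff]
  exact fun hd => absurd (Nat.le_of_dvd h0 hd) (by omega)

theorem T₃_lt_T₄ (h7 : 7 ≤ p) : T₃ (paley p hp) 0 < T₄ (paley p hp) 0 := by
  have h3 := natCast_ne_zero_of_lt p 3 (by omega) (by omega)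
  have h5 := natCast_ne_zero_of_lt p 5 (by omega) (by omega)
  have h2 := natCast_ne_zero_of_lt p 2 (by omega) (by omega)
  push_cast at h2 h3 h5
  refine lt_of_le_not_ge (T₃_le_T₄ p hp) fun hle => ?_
  -- As 4 = 2², biinvariance would equate the (1,1) and (1,4) entries of [W, M]. They are 0 and 1,
  -- because 4 ≠ 1 and 16 ≠ 1, that is, 3 and 5 are nonzero.
  let M : Matrix (ZMod p) (ZMod p) ℂ := fun x y => if y = 4 * x then 1 else 0
  have hM : M ∈ T₄ (paley p hp) 0 := by
    intro σ hσ x y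
    obtain ⟨a, ha, h⟩ := exists_eq_mul_of_mem_autStab p hp σ hσ
    simp only [M, h, mul_left_comm 4 a, mul_right_inj' ha]
  have h := (T₃_le_almostCentralizer p hp (hle hM)).2 1 2 one_ne_zero h2 1 1
  have h15 : (1 : ZMod p) ≠ 4 * 4 := fun h => mul_ne_zero h3 h5 (by linear_combination -h)
  have h4 : (1 : ZMod p) ≠ 4 := fun h => h3 (by linear_combination -h)
  have hi : (2 ^ 2 : ZMod p) = 4 := by norm_num
  have hi' : (4 : ZMod p)⁻¹ ≠ 4 := fun h => by
    have h40 : (4 : ZMod p) ≠ 0 := by rw [← hi]; exact pow_ne_zero 2 h2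
    exact h15 (by rw [← mul_inv_cancel₀ h40, h])
  rw [Matrix.sub_apply, Matrix.sub_apply] at h
  simp only [twistedInversion_mul_apply, mul_twistedInversion_apply] at h
  simp [M, hi, hi', h4] at h

end Prime
end TerwilligerPaley

namespace TerwilligerPaley

/-! ### The distance partition is the orbit partition. -/

section Distance

variable (p : ℕ) [Fact p.Prime] (hp : p % 4 = 1)

theorem paley_adj_zero_iff (x : ZMod p) :
    (paley p hp).Adj 0 x ↔ quadraticChar (ZMod p) x = 1 := by
  rw [(paley p hp).adj_comm, ← quadraticChar_sub_eq_one_iff, sub_zero]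

theorem edist_paley (x : ZMod p) : (paley p hp).edist 0 x =
    if quadraticChar (ZMod p) x = 0 then 0 else if quadraticChar (ZMod p) x = 1 then 1 else 2 := by
  split_ifs with h0 h1
  · rw [quadraticChar_eq_zero_iff] at h0
    rw [h0, SimpleGraph.edist_self]
  · rwa [SimpleGraph.edist_eq_one_iff_adj, paley_adj_zero_iff]
  · have hx0 : x ≠ 0 := by exact fun h => h0 (by rw [h, MulChar.map_zero])
    -- If the nonsquare x is a² + b², both terms are nonzero and 0, a², x is a path of length 2.
    obtain ⟨a, b, hab⟩ := ZMod.sq_add_sq p x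
    have ha : a ≠ 0 := by
      rintro rfl
      refine h1 ((quadraticChar_one_iff_isSquare hx0).2 ⟨b, ?_⟩)
      rw [← hab]; ring
    have hb : b ≠ 0 := by
      rintro rfl
      refine h1 ((quadraticChar_one_iff_isSquare hx0).2 ⟨a, ?_⟩)
      rw [← hab]; ring
    have had : (paley p hp).Adj 0 (a ^ 2) := by
      rw [paley_adj_zero_iff, quadraticChar_sq_one' ha]
    have hbd : (paley p hp).Adj (a ^ 2) x := by
      rw [(paley p hp).adj_comm, ← quadraticChar_sub_eq_one_iff, ← hab, add_sub_cancel_left,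
        quadraticChar_sq_one' hb]
    have hle := (paley p hp).edist_triangle (u := 0) (v := a ^ 2) (w := x)
    rw [SimpleGraph.edist_eq_one_iff_adj.2 had, SimpleGraph.edist_eq_one_iff_adj.2 hbd,
      one_add_one_eq_two] at hle
    have hne0 : (paley p hp).edist 0 x ≠ 0 := fun h => hx0 (SimpleGraph.edist_eq_zero_iff.1 h).symm
    have hne1 : (paley p hp).edist 0 x ≠ 1 := fun h =>
      h1 ((paley_adj_zero_iff p hp x).1 (SimpleGraph.edist_eq_one_iff_adj.1 h))
    generalize (paley p hp).edist 0 x = e at *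
    lift e to ℕ using ne_top_of_le_ne_top (by simp) hle
    norm_cast at *
    omega

theorem edist_paley_eq_iff (x y : ZMod p) :
    (paley p hp).edist 0 x = (paley p hp).edist 0 y ↔
      quadraticChar (ZMod p) x = quadraticChar (ZMod p) y := by
  refine ⟨fun h => ?_, fun h => by rw [edist_paley, edist_paley, h]⟩
  have hc (z : ZMod p) : quadraticChar (ZMod p) z = 0 ∨ quadraticChar (ZMod p) z = 1 ∨
      quadraticChar (ZMod p) z = -1 := by
    by_cases hz : z = 0
    · exact Or.inl (quadraticChar_eq_zero_iff.2 hz)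
    · exact Or.inr (quadraticChar_dichotomy hz)
  rw [edist_paley, edist_paley] at h
  rcases hc x with hx | hx | hx <;> rcases hc y with hy | hy | hy <;> rw [hx, hy] at h ⊢ <;>
    norm_num at h

theorem sphere_eq_orbit (k : ℕ) (y : ZMod p) (hy : (paley p hp).edist 0 y = k) :
    sphere (paley p hp) 0 k = MulAction.orbit (autStab (paley p hp) 0) y := by
  ext x
  rw [mem_orbit_iff, ← edist_paley_eq_iff p hp, hy]
  rfl

theorem T₂_eq_T₃ : T₂ (paley p hp) 0 = T₃ (paley p hp) 0 := by
  apply le_antisymm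
  · refine Algebra.adjoin_le ?_
    rintro M (rfl | ⟨k, rfl⟩)
    · exact Algebra.subset_adjoin (Or.inl rfl)
    · dsimp only
      rcases (sphere (paley p hp) 0 k).eq_empty_or_nonempty with h | ⟨y, hy⟩
      · rw [h]
        have h0 : diagIdem (∅ : Set (ZMod p)) = 0 := by
          ext x y
          simp [diagIdem_apply]
        rw [h0]
        exact (T₃ (paley p hp) 0).zero_mem
      · rw [sphere_eq_orbit p hp k y hy]
        exact Algebra.subset_adjoin (Or.inr ⟨y, rfl⟩)
  · refine Algebra.adjoin_le ?_
    rintro M (rfl | ⟨y, rfl⟩)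
    · exact Algebra.subset_adjoin (Or.inl rfl)
    · obtain ⟨k, hk⟩ : ∃ k : ℕ, (paley p hp).edist 0 y = k := by
        rw [edist_paley]
        split_ifs
        exacts [⟨0, rfl⟩, ⟨1, rfl⟩, ⟨2, rfl⟩]
      dsimp only
      rw [← sphere_eq_orbit p hp k y hk]
      exact Algebra.subset_adjoin (Or.inr ⟨k, rfl⟩)

theorem T₁_le_T₂ : T₁ (paley p hp) 0 ≤ T₂ (paley p hp) 0 := by
  refine Algebra.adjoin_le ?_
  rintro M (rfl | rfl)
  · exact Algebra.subset_adjoin (Or.inl rfl)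
  · refine Algebra.subset_adjoin (Or.inr ⟨0, congrArg _ ?_⟩)
    ext x
    change (paley p hp).edist 0 x = 0 ↔ x = 0
    rw [SimpleGraph.edist_eq_zero_iff, eq_comm]

end Distance

/-! ### An algebra containing T₁. -/

section Sharp

variable {F : Type*} [Field F] [Fintype F] [DecidableEq F] (hF : Fintype.card F % 4 = 1)

theorem adjMat_apply (x y : F) : adjMat (paleyGraph F hF) x y =
    if quadraticChar F (x - y) = 1 then 1 else 0 := by
  refine mul_left_cancel₀ (two_ne_zero (α := ℂ)) ?_
  rw [two_mul_adjMat_apply]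
  by_cases h : x = y
  · simp [h]
  · rcases quadraticChar_dichotomy (sub_ne_zero.2 h) with h' | h' <;> rw [h'] <;> norm_num [h]

omit [DecidableEq F] in
theorem ringChar_ne_two_of_card_mod_four (hF : Fintype.card F % 4 = 1) : ringChar F ≠ 2 := by
  intro h
  have := FiniteField.even_card_of_char_two h
  omega

/-- Strong regularity: A² is invariant under translations and square scalings, so its (x, y) entry
depends only on χ(x - y). The matrix M is constant. -/
theorem adjMat_mul_self : ∃ a b : ℂ, ∃ M : Matrix F F ℂ, SqBiinvariant M ∧
    adjMat (paleyGraph F hF) * adjMat (paleyGraph F hF) =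
      a • 1 + b • adjMat (paleyGraph F hF) + M := by
  set A := adjMat (paleyGraph F hF) with hA
  have htr (x y : F) : (A * A) x y = (A * A) (x - y) 0 := by
    rw [Matrix.mul_apply, Matrix.mul_apply,
      ← (Equiv.subRight y).sum_comp fun z => A (x - y) z * A z 0]
    refine Finset.sum_congr rfl fun z _ => ?_
    simp only [hA, adjMat_apply, Equiv.subRight_apply, sub_zero, sub_sub_sub_cancel_right]
  have hsq (s z : F) (hs : s ≠ 0) : (A * A) (s ^ 2 * z) 0 = (A * A) z 0 := by
    have h := (sqInvariant_adjMat hF).mul (sqInvariant_adjMat hF) s hs z 0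
    rwa [mul_zero] at h
  obtain ⟨n, hn⟩ := quadraticChar_exists_neg_one (ringChar_ne_two_of_card_mod_four hF)
  have hn0 : n ≠ 0 := by rintro rfl; simp at hn
  refine ⟨(A * A) 0 0 - (A * A) n 0, (A * A) 1 0 - (A * A) n 0, fun _ _ => (A * A) n 0,
    fun _ _ _ _ _ _ => rfl, ?_⟩
  ext x y
  change (A * A) x y = ((A * A) 0 0 - (A * A) n 0) * (1 : Matrix F F ℂ) x y +
    ((A * A) 1 0 - (A * A) n 0) * A x y + (A * A) n 0
  rw [htr x y, Matrix.one_apply, show A x y = _ from adjMat_apply hF x y]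
  by_cases h : x = y
  · simp [h]
  have h' := sub_ne_zero.2 h
  by_cases hs : quadraticChar F (x - y) = 1
  · obtain ⟨s, hs'⟩ := (quadraticChar_one_iff_isSquare h').1 hs
    have hs0 : s ≠ 0 := by rintro rfl; rw [mul_zero] at hs'; exact h' hs'
    have h1 : x - y = s ^ 2 * 1 := by rw [hs']; ring
    rw [if_pos hs, if_neg h, h1, hsq s 1 hs0]
    ring
  · have h2 : quadraticChar F ((x - y) / n) = 1 := by
      have h3 : quadraticChar F ((x - y) / n) * quadraticChar F n = quadraticChar F (x - y) := by
        rw [← map_mul, div_mul_cancel₀ _ hn0]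
      rw [(quadraticChar_dichotomy h').resolve_left hs, hn] at h3
      linarith
    obtain ⟨s, hs'⟩ := (quadraticChar_one_iff_isSquare (div_ne_zero h' hn0)).1 h2
    have hs0 : s ≠ 0 := by rintro rfl; rw [mul_zero] at hs'; exact div_ne_zero h' hn0 hs'
    have h1 : x - y = s ^ 2 * n := by rw [pow_two, ← hs', div_mul_cancel₀ _ hn0]
    rw [if_neg hs, if_neg h, h1, hsq s n hs0]
    ring

/-- The sum of the adjacency algebra of the Paley graph and the biinvariant matrices. -/
def adjacencyAddBiinvariant : Subalgebra ℂ (Matrix F F ℂ) where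
  carrier := {M | ∃ a b : ℂ, ∃ N : Matrix F F ℂ, SqBiinvariant N ∧
    M = a • 1 + b • adjMat (paleyGraph F hF) + N}
  mul_mem' := by
    rintro _ _ ⟨a, b, M, hM, rfl⟩ ⟨c, d, N, hN, rfl⟩
    obtain ⟨e, f, K, hK, h⟩ := adjMat_mul_self hF
    have hA := sqInvariant_adjMat hF
    refine ⟨a * c + b * d * e, a * d + b * c + b * d * f,
      a • N + c • M + (b * d) • K + b • (adjMat (paleyGraph F hF) * N) +
        d • (M * adjMat (paleyGraph F hF)) + M * N, ?_, ?_⟩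
    · exact (((((hN.smul a).add (hM.smul c)).add (hK.smul _)).add
        ((hA.mul_sqBiinvariant hN).smul b)).add ((hM.mul_sqInvariant hA).smul d)).add
        (hM.sqInvariant.mul_sqBiinvariant hN)
    · have hx : (a • 1 + b • adjMat (paleyGraph F hF) + M) *
          (c • 1 + d • adjMat (paleyGraph F hF) + N) =
          (a * c) • 1 + (a * d + b * c) • adjMat (paleyGraph F hF) +
          (b * d) • (adjMat (paleyGraph F hF) * adjMat (paleyGraph F hF)) + (a • N + c • M +
          b • (adjMat (paleyGraph F hF) * N) + d • (M * adjMat (paleyGraph F hF)) + M * N) := by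
        simp only [mul_add, add_mul, smul_mul_assoc, mul_smul_comm, one_mul, mul_one]
        module
      rw [hx, h]
      module
  add_mem' := by
    rintro _ _ ⟨a, b, M, hM, rfl⟩ ⟨c, d, N, hN, rfl⟩
    exact ⟨a + c, b + d, M + N, hM.add hN, by module⟩
  algebraMap_mem' c := ⟨c, 0, 0, sqBiinvariant_zero, by
    rw [Algebra.algebraMap_eq_smul_one]; module⟩

theorem T₁_le_adjacencyAddBiinvariant :
    T₁ (paleyGraph F hF) 0 ≤ adjacencyAddBiinvariant hF := by
  refine Algebra.adjoin_le ?_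
  rintro M (rfl | rfl)
  · exact ⟨0, 1, 0, sqBiinvariant_zero, by module⟩
  · refine ⟨0, 0, diagIdem {0}, fun s t hs ht x y => ?_, by module⟩
    simp only [diagIdem_apply, Set.mem_singleton_iff]
    refine if_congr ⟨?_, ?_⟩ rfl rfl
    · rintro ⟨h, h0⟩
      have hx : x = 0 := by simpa [hs] using h0
      have hy : y = 0 := by simpa [hx, ht] using h
      exact ⟨hx.trans hy.symm, hx⟩
    · rintro ⟨rfl, rfl⟩
      simp

end Sharp

/-! ### Strictness of T₁ ⊂ T₂. -/

section Strict

variable (p : ℕ) [Fact p.Prime] (hp : p % 4 = 1)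

theorem exists_quadraticChar_sq_sub_one_eq_one (h7 : 7 ≤ p) :
    ∃ x : ZMod p, x ≠ 0 ∧ quadraticChar (ZMod p) (x ^ 2 - 1) = 1 := by
  have h2 := natCast_ne_zero_of_lt p 2 (by omega) (by omega)
  have h3 := natCast_ne_zero_of_lt p 3 (by omega) (by omega)
  have h5 := natCast_ne_zero_of_lt p 5 (by omega) (by omega)
  push_cast at h2 h3 h5
  have h4 : (4 : ZMod p) ≠ 0 := by
    rw [show (4 : ZMod p) = 2 * 2 by norm_num]
    exact mul_ne_zero h2 h2
  -- The Pythagorean triple 3, 4, 5.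
  refine ⟨5 / 4, div_ne_zero h5 h4, ?_⟩
  rw [show ((5 : ZMod p) / 4) ^ 2 - 1 = (3 / 4) ^ 2 by field_simp; norm_num]
  exact quadraticChar_sq_one' (div_ne_zero h3 h4)

theorem exists_quadraticChar_sq_sub_one_eq_neg_one (hp : p % 4 = 1) :
    ∃ x : ZMod p, x ≠ 0 ∧ quadraticChar (ZMod p) (x ^ 2 - 1) = -1 := by
  by_contra! h
  have hm : IsSquare (-1 : ZMod p) :=
    FiniteField.isSquare_neg_one_iff.2 (by rw [ZMod.card]; omega)
  -- Under the negated claim squares are closed under subtracting 1, so every element would be a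
  -- square.
  have hstep (y : ZMod p) (hy : IsSquare y) : IsSquare (y - 1) := by
    obtain ⟨x, rfl⟩ := hy
    by_cases hx : x = 0
    · rwa [hx, mul_zero, zero_sub]
    · by_contra hn
      rw [← pow_two] at hn
      exact h x hx (quadraticChar_neg_one_iff_not_isSquare.2 hn)
  have hall (k : ℕ) : IsSquare (-(k : ZMod p)) := by
    induction k with
    | zero => simp
    | succ k ih =>
      have := hstep _ ih
      rwa [Nat.cast_succ, neg_add']
  obtain ⟨n, hn⟩ := FiniteField.exists_nonsquare (F := ZMod p)
    (by rw [ZMod.ringChar_zmod_n]; omega)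
  refine hn ?_
  rw [← neg_neg n, ← ZMod.natCast_zmod_val (-n)]
  exact hall _

theorem T₁_lt_T₂ (h7 : 7 ≤ p) : T₁ (paley p hp) 0 < T₂ (paley p hp) 0 := by
  refine lt_of_le_not_ge (T₁_le_T₂ p hp) fun hle => ?_
  have hF : Fintype.card (ZMod p) % 4 = 1 := by rwa [ZMod.card]
  have hE : diagIdem (sphere (paley p hp) 0 1) ∈ T₂ (paley p hp) 0 :=
    Algebra.subset_adjoin (Or.inr ⟨1, rfl⟩)
  obtain ⟨a, b, N, hN, h⟩ := T₁_le_adjacencyAddBiinvariant hF (hle hE)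
  have hentry (x y : ZMod p) : (if x = y ∧ quadraticChar (ZMod p) x = 1 then (1 : ℂ) else 0) =
      a * (if x = y then 1 else 0) +
        b * (if quadraticChar (ZMod p) (x - y) = 1 then 1 else 0) + N x y := by
    rw [← adjMat_apply hF, ← Matrix.one_apply, ← smul_eq_mul, ← smul_eq_mul, ← Matrix.smul_apply,
      ← Matrix.smul_apply, ← Matrix.add_apply, ← Matrix.add_apply, ← h, diagIdem_apply]
    classical
    refine if_congr (and_congr_right fun _ => ?_) rfl rfl
    rw [← paley_adj_zero_iff p hp, ← SimpleGraph.edist_eq_one_iff_adj]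
    exact Iff.rfl
  -- The entries at (x², 1) all equal N 1 1; choosing χ(x² - 1) = -1, then 1, gives N 1 1 = 0 and b
  -- = 0.
  have hsq (x : ZMod p) (hx : x ≠ 0) : N (x ^ 2) 1 = N 1 1 := by
    simpa using hN x 1 hx one_ne_zero 1 1
  have hN11 : N 1 1 = 0 := by
    obtain ⟨x, hx, hx'⟩ := exists_quadraticChar_sq_sub_one_eq_neg_one p hp
    have hne : x ^ 2 ≠ 1 := fun h => by simp [h] at hx'
    have h1 := hentry (x ^ 2) 1
    rw [hx', hsq x hx] at h1
    norm_num [hne] at h1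
    exact h1.symm
  have hb : b = 0 := by
    obtain ⟨x, hx, hx'⟩ := exists_quadraticChar_sq_sub_one_eq_one p h7
    have hne : x ^ 2 ≠ 1 := fun h => by simp [h] at hx'
    have h1 := hentry (x ^ 2) 1
    rw [hx', hsq x hx, hN11] at h1
    norm_num [hne] at h1
    exact h1.symm
  have ha : a = 1 := by
    have h1 := hentry 1 1
    simpa [hN11, hb, eq_comm] using h1
  obtain ⟨n, hn⟩ := quadraticChar_exists_neg_one (ringChar_ne_two_of_card_mod_four hF)
  have hn0 : n ≠ 0 := by rintro rfl; simp at hn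
  have h2 := natCast_ne_zero_of_lt p 2 (by omega) (by omega)
  have h3 := natCast_ne_zero_of_lt p 3 (by omega) (by omega)
  push_cast at h2 h3
  -- For a nonsquare n, the entry at (n, 4n) gives N n n = 0 while the one at (n, n) gives N n n =
  -- -1.
  have hne : n ≠ 2 ^ 2 * n := fun h => mul_ne_zero h3 hn0 (by linear_combination -h)
  have h4 := hentry n (2 ^ 2 * n)
  have h5 := hentry n n
  have h6 := hN 1 2 one_ne_zero h2 n n
  rw [one_pow, one_mul] at h6
  rw [if_neg fun h => hne h.1, if_neg hne, hb, h6] at h4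
  rw [hn, ha, hb] at h5
  norm_num at h4 h5
  rw [← h4] at h5
  norm_num at h5

end Strict
end TerwilligerPaley

open TerwilligerPaley in
theorem mainTheorem1 :
    (∀ (p : ℕ) [Fact p.Prime] (hp : p % 4 = 1), 7 ≤ p →
      T₁ (paley p hp) 0 < T₂ (paley p hp) 0 ∧
      T₂ (paley p hp) 0 = T₃ (paley p hp) 0 ∧
      T₃ (paley p hp) 0 < T₄ (paley p hp) 0) ∧
    Set.Infinite {p : ℕ | ∃ (_ : Fact p.Prime) (hp : p % 4 = 1),
      T₃ (paley p hp) 0 ≠ T₄ (paley p hp) 0} := by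
  refine ⟨fun p _ hp h7 => ⟨T₁_lt_T₂ p hp h7, T₂_eq_T₃ p hp, T₃_lt_T₄ p hp h7⟩, ?_⟩
  refine Set.infinite_of_not_bddAbove fun ⟨n, hn⟩ => ?_
  -- The bound n + 7 secures both p > n and p ≥ 7.
  obtain ⟨p, hpp, hlt, hmod⟩ := Nat.exists_prime_gt_modEq_one (k := 4) (n + 7) (by norm_num)
  have : Fact p.Prime := ⟨hpp⟩
  have hp : p % 4 = 1 := hmod
  have := hn ⟨this, hp, (T₃_lt_T₄ p hp (by omega)).ne⟩
  omega
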